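/- Let $\mathcal M\subseteq\mathbb R^{d\times r}$ be a smooth submanifold with a Riemannian metric $\langle\cdot,\cdot\rangle_X$ such that $\nu\|E\|_F^2\le\langle E,E\rangle_X\le\gamma\|E\|_F^2$ for all $X\in\mathcal M$, $E\in T_X\mathcal M$, with constants $\nu,\gamma>0$. Let $f=\frac1n\sum_{i=1}^n f_i$ with $n\ge1$, where every $f_i$ is differentiable and $\|\nabla f_i(X)-\nabla f_i(Y)\|_F\le L\|X-Y\|_F$ for all $X,Y\in\mathcal M$ ($L>0$, $\nabla$ the Euclidean gradient). Let $\mathrm{grad} f(X)\in T_X\mathcal M$ be the Riemannian gradient. Let $\mathcal R$ be a retraction: for each $X\in\mathcal M$, $\mathcal R(X,\cdot):T_X\mathcal M\to\mathcal M$ is smooth, $\mathcal R(X,0)=X$ and $\frac{d}{dt}\mathcal R(X,tE)|_{t=0}=E$. Assume that for constants $L_1\ge1$, $L_2,\hat L,T>0$ and all $X\in\mathcal M$, $E\in T_X\mathcal M$, $t\in[0,T]$, $$\|\mathcal R(X,tE)-X\|_F\le L_1t\|E\|_F,\qquad \|\mathcal R(X,tE)-X-tE\|_F\le L_2t^2\|E\|_F^2,$$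 $$f(\mathcal R(X,tE))\le f(X)+t\langle\mathrm{grad} f(X),E\rangle_X+\tfrac{\hat L}{2}t^2\|E\|_F^2 .$$ The method S-SVRG, with starting point $X^{0,0}\in\mathcal M$, $S\ge1$ epochs of length $K$, batch size $|B|$ and step size $\tau$, does the following. In epoch $s=0,\dots,S-1$ it computes $\nabla f(X^{s,0})$; then for $k=0,\dots,K-1$ it draws $|B|$ indices from $\{1,\dots,n\}$ independently and uniformly (with replacement), forms $$\mathcal G=\nabla f(X^{s,0})+\frac1{|B|}\sum_{i\in B}\big(\nabla f_i(X^{s,k})-\nabla f_i(X^{s,0})\big),$$ computes $\mathcal G^{R}\in T_{X^{s,k}}\mathcal M$ with $\langle \mathcal G^R,E\rangle_{X^{s,k}}=\langle\mathcal G,E\rangle$ for all $E\in T_{X^{s,k}}\mathcal M$, and sets $X^{s,k+1}=\mathcal R(X^{s,k},-\tau\mathcal G^R)$. At the end of the epoch it sets $X^{s+1,0}=X^{s,K}$ and lets $X_r^s$ be $X^{s,k}$ with probability $p_k$, $k=0,\dots,K$. It returns $X_r$, drawn uniformly from $\{X_r^0,\dots,X_r^{S-1}\}$. An IFO call is the evaluation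 of one $\nabla f_i$ at one point; an RO call is one evaluation of $\mathcal R$. Let $0\le\theta\le1$, $\kappa>0$, and let $c\in(0,1)$ satisfy $$\frac{\hat L}{L_1L}\Big(\frac{c+1}{c+2}e^{c^2+2c}+\frac1{c+2}\Big)c\le1 .$$ Put $$K=\lceil(\kappa n)^{1/(3-2\theta)}\rceil,\quad |B|=\lceil K^{2-2\theta}\rceil,\quad \beta=\frac cK,\quad \tau=bK^{-\theta},\quad b=\min\Big\{\frac{c\nu}{L_1L},1,T\Big\},$$ $$\Gamma(z,i)=\frac{(1+z)^{i-1}-1}{z},\qquad \frac{\Delta_k}{\tau}=\nu-\frac{\hat L}2\tau\Big[1+(1+\beta^{-1})\frac{L^2L_1^2\tau^2}{\nu^2|B|}\,\Gamma\Big(\beta+(1+\beta^{-1})\frac{L^2L_1^2\tau^2}{\nu^2|B|},\,K-k\Big)\Big],$$ and $p_k=\Delta_k/\sum_{j=0}^{K-1}\Delta_j$ for $0\le k\le K-1$, $p_K=0$. Then $(p_k)$ is a probability vector, and for every $D$ there is a constant $C$, depending only on $\theta,\kappa,c,\nu,L,L_1,\hat L,T,D$, with the following property. For all $n\ge1$ and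 $\epsilon>0$ there is a number $S\ge1$ of epochs such that, for all problems as above with $f(X^{0,0})-\inf_{\mathcal M}f\le D$, S-SVRG returns a stochastic $\epsilon$-stationary point, $$\mathbb E\big[\|\mathrm{grad} f(X_r)\|_F^2\big]\le\epsilon ,$$ and uses at most $$C\Big(\frac{n^{\frac{2-\theta}{3-2\theta}}}{\epsilon}+n\Big)\ \text{IFO calls}\quad\text{and}\quad C\Big(\frac{n^{\frac{\theta}{3-2\theta}}}{\epsilon}+n^{\frac1{3-2\theta}}\Big)\ \text{RO calls.}$$ In particular, for $\theta=0$ these bounds are $C(n^{2/3}/\epsilon+n)$ and $C(1/\epsilon+n^{1/3})$. -/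

import Mathlib

open scoped Manifold ContDiff Bundle
open Bundle

noncomputable section

namespace SSVRG

/-- The space of real `d × r` matrices with the Frobenius inner product and norm. -/
abbrev Mat (d r : ℕ) : Type := EuclideanSpace ℝ (Fin d × Fin r)

/-! ### Computations that count oracle calls -/

/-- A computed value together with the number of component gradient evaluations (`ifo`) and of
retraction evaluations (`ro`) that were spent on it. -/
structure Counted (α : Type*) where
  val : α
  ifo : ℕ
  ro : ℕ

namespace Counted

/-- Return a value without any oracle call. -/
def pure {α : Type*} (a : α) : Counted α := ⟨a, 0, 0⟩

/-- Sequential composition: the calls of both parts are added. -/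
def bind {α β : Type*} (p : Counted α) (q : α → Counted β) : Counted β :=
  ⟨(q p.val).val, p.ifo + (q p.val).ifo, p.ro + (q p.val).ro⟩

/-- Evaluate `h` at all entries of a list, one after the other, and sum up the results. -/
def sumList {α V : Type*} [AddCommGroup V] (h : α → Counted V) : List α → Counted V
  | [] => pure 0
  | a :: l => (h a).bind fun u => (sumList h l).bind fun w => pure (u + w)

end Counted

/-! ### The geometry: a Riemannian manifold `M` lying in the matrix space through `emb` -/

section Geometry

variable {d r m : ℕ} {M : Type*} [TopologicalSpace M] [ChartedSpace (EuclideanSpace ℝ (Fin m)) M]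

/-- `emb : M → Mat d r` is an injective smooth immersion, i.e. it presents `M` as a submanifold of
the matrix space. -/
structure IsSubmanifold (m : ℕ) {d r : ℕ} {M : Type*} [TopologicalSpace M]
    [ChartedSpace (EuclideanSpace ℝ (Fin m)) M] (emb : M → Mat d r) : Prop where
  smooth : ContMDiff (𝓡 m) 𝓘(ℝ, Mat d r) ∞ emb
  injective : Function.Injective emb
  immersion : ∀ x : M, Function.Injective (mfderiv (𝓡 m) 𝓘(ℝ, Mat d r) emb x)

/-- The tangent vector `v` of `M` at `x`, seen as a matrix. -/
def tangentMat (emb : M → Mat d r) (x : M) (v : TangentSpace (𝓡 m) x) : Mat d r :=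
  mfderiv (𝓡 m) 𝓘(ℝ, Mat d r) emb x v

/-- `R x : T_x M → M` is smooth, with `R x 0 = x` and `d/dt R x (t v) = v` at `t = 0`. -/
structure IsRetraction (emb : M → Mat d r) (R : (x : M) → TangentSpace (𝓡 m) x → M) : Prop where
  smooth : ∀ x : M, ContMDiff 𝓘(ℝ, EuclideanSpace ℝ (Fin m)) (𝓡 m) ∞
    (fun v : EuclideanSpace ℝ (Fin m) => R x v)
  map_zero : ∀ x : M, R x 0 = x
  deriv_zero : ∀ (x : M) (v : TangentSpace (𝓡 m) x),
    HasDerivAt (fun t : ℝ => emb (R x (t • v))) (tangentMat emb x v) 0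

/-- First and second order bounds for the retraction on `[0, T]`. -/
def RetractionBounds (emb : M → Mat d r) (R : (x : M) → TangentSpace (𝓡 m) x → M)
    (L₁ L₂ T : ℝ) : Prop :=
  ∀ (x : M) (v : TangentSpace (𝓡 m) x) (t : ℝ), 0 ≤ t → t ≤ T →
    ‖emb (R x (t • v)) - emb x‖ ≤ L₁ * t * ‖tangentMat emb x v‖ ∧
    ‖emb (R x (t • v)) - emb x - t • tangentMat emb x v‖ ≤
      L₂ * t ^ 2 * ‖tangentMat emb x v‖ ^ 2

variable [RiemannianBundle (fun x : M => TangentSpace (𝓡 m) x)]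

/-- The Riemannian metric is equivalent to the Frobenius inner product, uniformly on `M`. -/
def MetricEquivalent (m : ℕ) {d r : ℕ} {M : Type*} [TopologicalSpace M]
    [ChartedSpace (EuclideanSpace ℝ (Fin m)) M]
    [RiemannianBundle (fun x : M => TangentSpace (𝓡 m) x)] (emb : M → Mat d r) (ν γ : ℝ) : Prop :=
  ∀ (x : M) (v : TangentSpace (𝓡 m) x),
    ν * ‖tangentMat emb x v‖ ^ 2 ≤ inner ℝ v v ∧ inner ℝ v v ≤ γ * ‖tangentMat emb x v‖ ^ 2

/-- The tangent vector that represents a linear form `φ` on `T_x M` in the Riemannian metric. -/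
def riesz (x : M) (φ : TangentSpace (𝓡 m) x →L[ℝ] ℝ) : TangentSpace (𝓡 m) x :=
  have : FiniteDimensional ℝ (TangentSpace (𝓡 m) x) :=
    inferInstanceAs (FiniteDimensional ℝ (EuclideanSpace ℝ (Fin m)))
  have : CompleteSpace (TangentSpace (𝓡 m) x) := FiniteDimensional.complete ℝ _
  (InnerProductSpace.toDual ℝ (TangentSpace (𝓡 m) x)).symm φ

/-- The defining property of `riesz`. -/
theorem inner_riesz (x : M) (φ : TangentSpace (𝓡 m) x →L[ℝ] ℝ) (v : TangentSpace (𝓡 m) x) :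
    inner ℝ (riesz x φ) v = φ v := by
  have : FiniteDimensional ℝ (TangentSpace (𝓡 m) x) :=
    inferInstanceAs (FiniteDimensional ℝ (EuclideanSpace ℝ (Fin m)))
  have : CompleteSpace (TangentSpace (𝓡 m) x) := FiniteDimensional.complete ℝ _
  exact InnerProductSpace.toDual_symm_apply

/-- The Riemannian gradient of `h : M → ℝ`: `⟨grad h(x), v⟩_x = D h(x)[v]` for all `v`. -/
def riemannianGrad (h : M → ℝ) (x : M) : TangentSpace (𝓡 m) x :=
  riesz x (mfderiv (𝓡 m) 𝓘(ℝ, ℝ) h x)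

/-- The tangent vector `w` at `x` that belongs to a Euclidean vector `G`:
`⟨w, v⟩_x = ⟨G, v⟩` for all tangent vectors `v`. -/
def toTangent (emb : M → Mat d r) (x : M) (G : Mat d r) : TangentSpace (𝓡 m) x :=
  riesz x ((innerSL ℝ G).comp (mfderiv (𝓡 m) 𝓘(ℝ, Mat d r) emb x))

/-- Defining property of the Riemannian counterpart of a Euclidean vector. -/
theorem inner_toTangent (emb : M → Mat d r) (x : M) (G : Mat d r) (v : TangentSpace (𝓡 m) x) :
    inner ℝ (toTangent emb x G) v = inner ℝ G (tangentMat emb x v) :=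
  inner_riesz x _ v

end Geometry

/-! ### The objective -/

/-- The finite-sum objective `f = (1/n) ∑ f_i`, restricted to `M`. -/
def objective {d r n : ℕ} {M : Type*} (emb : M → Mat d r) (f : Fin n → Mat d r → ℝ) (x : M) : ℝ :=
  (1 / (n : ℝ)) * ∑ i, f i (emb x)

/-- All `f_i` are differentiable at the points of `M`, and their Euclidean gradients are
`L`-Lipschitz over `M`. -/
def LipschitzGradients {d r n : ℕ} {M : Type*} (emb : M → Mat d r) (f : Fin n → Mat d r → ℝ)
    (L : ℝ) : Prop :=
  ∀ i, (∀ x : M, DifferentiableAt ℝ (f i) (emb x)) ∧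
    ∀ x y : M, ‖gradient (f i) (emb x) - gradient (f i) (emb y)‖ ≤ L * ‖emb x - emb y‖

/-- The descent inequality `h(R(t)) ≤ h(x) + t ⟨grad h(x), v⟩_x + (L̂/2) t² ‖v‖_F²` along
`R(t) = R x (t v)`, for `t ∈ [0, T]`. -/
def DescentInequality {d r m : ℕ} {M : Type*} [TopologicalSpace M]
    [ChartedSpace (EuclideanSpace ℝ (Fin m)) M]
    [RiemannianBundle (fun x : M => TangentSpace (𝓡 m) x)]
    (emb : M → Mat d r) (R : (x : M) → TangentSpace (𝓡 m) x → M) (h : M → ℝ) (Lhat T : ℝ) : Prop :=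
  ∀ (x : M) (v : TangentSpace (𝓡 m) x) (t : ℝ), 0 ≤ t → t ≤ T →
    h (R x (t • v)) ≤ h x + t * inner ℝ (riemannianGrad h x) v
      + Lhat / 2 * t ^ 2 * ‖tangentMat emb x v‖ ^ 2

/-! ### The algorithm -/

/-- One call of the incremental first-order oracle: the Euclidean gradient of one component. -/
def gradCall {d r n : ℕ} {M : Type*} (emb : M → Mat d r) (f : Fin n → Mat d r → ℝ)
    (x : M) (i : Fin n) : Counted (Mat d r) :=
  ⟨gradient (f i) (emb x), 1, 0⟩

/-- The full Euclidean gradient. -/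
def fullGradient {d r n : ℕ} {M : Type*} (emb : M → Mat d r) (f : Fin n → Mat d r → ℝ) (x : M) :
    Counted (Mat d r) :=
  (Counted.sumList (gradCall emb f x) (List.finRange n)).bind fun G =>
    Counted.pure ((1 / (n : ℝ)) • G)

/-- The variance reduced stochastic Euclidean gradient at `x`, with reference point `x₀`, full
gradient `G₀` at `x₀`, and the sample `b` of `B` indices (drawn with replacement). -/
def stochasticGradient {d r n B : ℕ} {M : Type*} (emb : M → Mat d r) (f : Fin n → Mat d r → ℝ)
    (x₀ : M) (G₀ : Mat d r) (b : Fin B → Fin n) (x : M) : Counted (Mat d r) :=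
  (Counted.sumList (fun i => (gradCall emb f x i).bind fun u =>
      (gradCall emb f x₀ i).bind fun w => Counted.pure (u - w)) (List.ofFn b)).bind fun G =>
    Counted.pure (G₀ + (1 / (B : ℝ)) • G)

section Algorithm

variable {d r m n B K S : ℕ} {M : Type*} [TopologicalSpace M]
  [ChartedSpace (EuclideanSpace ℝ (Fin m)) M]

/-- One call of the retraction oracle. -/
def retractionCall (R : (x : M) → TangentSpace (𝓡 m) x → M) (x : M) (v : TangentSpace (𝓡 m) x) :
    Counted M :=
  ⟨R x v, 0, 1⟩

variable [RiemannianBundle (fun x : M => TangentSpace (𝓡 m) x)]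

/-- One inner iteration: `x` is moved to `R x (-τ G)`, where `G` is the stochastic Riemannian
gradient. -/
def innerStep (emb : M → Mat d r) (f : Fin n → Mat d r → ℝ)
    (R : (x : M) → TangentSpace (𝓡 m) x → M) (τ : ℝ) (x₀ : M) (G₀ : Mat d r) (b : Fin B → Fin n)
    (x : M) : Counted M :=
  (stochasticGradient emb f x₀ G₀ b x).bind fun G => retractionCall R x (-(τ • toTangent emb x G))

/-- The first `k` inner iterations of an epoch that starts at `x₀`, with samples `ξ`. -/
def epoch (emb : M → Mat d r) (f : Fin n → Mat d r → ℝ)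
    (R : (x : M) → TangentSpace (𝓡 m) x → M) (τ : ℝ) (ξ : Fin K → Fin B → Fin n) (x₀ : M)
    (k : Fin (K + 1)) : Counted M :=
  (fullGradient emb f x₀).bind fun G₀ =>
    Fin.induction (motive := fun _ => Counted M) (Counted.pure x₀)
      (fun j p => p.bind (innerStep emb f R τ x₀ G₀ (ξ j))) k

/-- The first `s` epochs, started at `x₀`, each of them with its last inner iterate as the result;
`τ s` is the step size of epoch `s`. -/
def epochs (emb : M → Mat d r) (f : Fin n → Mat d r → ℝ)
    (R : (x : M) → TangentSpace (𝓡 m) x → M) (τ : Fin S → ℝ) (ξ : Fin S → Fin K → Fin B → Fin n)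
    (x₀ : M) (s : Fin (S + 1)) : Counted M :=
  Fin.induction (motive := fun _ => Counted M) (Counted.pure x₀)
    (fun j p => p.bind fun y => epoch emb f R (τ j) (ξ j) y (Fin.last K)) s

/-- The iterate `X^{s,k}`. -/
def iterate (emb : M → Mat d r) (f : Fin n → Mat d r → ℝ)
    (R : (x : M) → TangentSpace (𝓡 m) x → M) (τ : Fin S → ℝ) (ξ : Fin S → Fin K → Fin B → Fin n)
    (x₀ : M) (s : Fin S) (k : Fin (K + 1)) : M :=
  ((epochs emb f R τ ξ x₀ s.castSucc).bind fun y => epoch emb f R (τ s) (ξ s) y k).val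

/-- All random choices of a run: the mini-batches `ξ_{s,k}`, the index `k` of the iterate that is
selected in each epoch, and the epoch whose selected iterate is returned. -/
abbrev Seed (n B K S : ℕ) : Type :=
  (Fin S → Fin K → Fin B → Fin n) × (Fin S → Fin (K + 1)) × Fin S

/-- A complete run: `S` epochs of `K` inner iterations are executed, and then the selected
iterate is returned. -/
def run (emb : M → Mat d r) (f : Fin n → Mat d r → ℝ)
    (R : (x : M) → TangentSpace (𝓡 m) x → M) (τ : Fin S → ℝ) (x₀ : M) (σ : Seed n B K S) :
    Counted M :=
  (epochs emb f R τ σ.1 x₀ (Fin.last S)).bind fun _ =>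
    Counted.pure (iterate emb f R τ σ.1 x₀ σ.2.2 (σ.2.1 σ.2.2))

end Algorithm

/-- The probability of a seed: all sampled indices are independent and uniform on the `n`
components, epoch `s` selects the iterate `k` with probability `p s k`, the returned epoch is
uniform, and all these choices are independent. -/
def seedProb {n B K S : ℕ} (p : Fin S → Fin (K + 1) → ℝ) (σ : Seed n B K S) : ℝ :=
  (∏ _s : Fin S, ∏ _k : Fin K, ∏ _j : Fin B, (1 / (n : ℝ))) * (∏ s, p s (σ.2.1 s)) *
    (1 / (S : ℝ))

/-- Expectation over all random choices of the algorithm. -/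
def expectation {n B K S : ℕ} (p : Fin S → Fin (K + 1) → ℝ) (φ : Seed n B K S → ℝ) : ℝ :=
  ∑ σ, seedProb p σ * φ σ

/-! ### The parameters -/

/-- `K = ⌈(κ n)^{1/(3-2θ)}⌉`. -/
def innerLength (θ κ : ℝ) (n : ℕ) : ℕ := ⌈(κ * n) ^ (1 / (3 - 2 * θ))⌉₊

/-- `|B| = ⌈K^{2-2θ}⌉`. -/
def batchSize (θ : ℝ) (K : ℕ) : ℕ := ⌈(K : ℝ) ^ (2 - 2 * θ)⌉₊

/-- `b = min {c ν / (L₁ L), 1, T}`. -/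
def stepFactor (c ν L₁ L T : ℝ) : ℝ := min (min (c * ν / (L₁ * L)) 1) T

/-- `τ = b K^{-θ}`. -/
def stepSize (b θ : ℝ) (K : ℕ) : ℝ := b * (K : ℝ) ^ (-θ)

/-- `Γ(z, i) = ((1 + z)^{i-1} - 1) / z`, used for `i ≥ 1`. -/
def Gam (z : ℝ) (i : ℕ) : ℝ := ((1 + z) ^ (i - 1) - 1) / z

/-- The weights `Δ_k`, for `k < K`. -/
def Delta (ν L L₁ Lhat β τ : ℝ) (B K k : ℕ) : ℝ :=
  τ * (ν - Lhat / 2 * τ * (1 + (1 + β⁻¹) * (L ^ 2 * L₁ ^ 2 * τ ^ 2 / (ν ^ 2 * B)) *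
    Gam (β + (1 + β⁻¹) * (L ^ 2 * L₁ ^ 2 * τ ^ 2 / (ν ^ 2 * B))) (K - k)))

/-- `p_k = Δ_k / ∑_{j<K} Δ_j` for `k < K`, and `p_K = 0`. -/
def selectProb (Δ : ℕ → ℝ) (K : ℕ) (k : Fin (K + 1)) : ℝ :=
  if (k : ℕ) < K then Δ k / ∑ j ∈ Finset.range K, Δ j else 0

end SSVRG

end

open scoped Manifold ContDiff Bundle BigOperators
open Bundle

noncomputable section

/-! The proof is a Lyapunov argument. In an epoch started at `x₀`, the potential `f(x) + l_k ‖x -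
x₀‖²` decreases in the mean by at least `Δ_k ‖grad f(x)‖²` in step `k`. The sampled direction is
unbiased, and its error after projection has second moment at most `L² ‖x - x₀‖² / (ν² |B|)`
(`expect_le_of_minibatch`). The penalty absorbs this error, because its own growth is controlled by
Young's inequality with weight `β` and the first order retraction bound (`expect_innerStep_le`).
Matching coefficients of `‖x - x₀‖²` gives a linear backward recursion for `l_k`; with `l_K = 0` its
solution is a multiple of `Γ`, and the remaining coefficient of the squared gradient is exactly
`Δ_k`.

The penalty vanishes at both ends of an epoch, so the estimates telescope over inner steps and
epochs. Selecting with `p_k` proportional to `Δ_k` turns the weighted sum into the mean at the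
returned point, bounded by `D / (S ∑ Δ_k)` (`expectation_gradNormSq_le`). The condition on `c` gives
`Δ_k ≥ τν/2` (`half_le_Delta`), hence `∑ Δ_k ≥ bν K^{1-θ}/2`, and `S` of order `1/(K^{1-θ} ε)`, up
to an additive constant, suffices. An epoch costs `n + 2K|B|` gradients and `K` retractions; since
`K^{3-2θ}` is of order `n`, `exists_cost_bound` yields the rates.

All randomness is finite and uniform apart from the selection, so conditional expectations become
iterated averages. -/

namespace SSVRG

/-! ### Averages over finite sample spaces, and the mini-batch estimate. -/

section Averages

/-- Averages over sequences split off the first entry. -/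
theorem expect_fin_cons {Ω : Type*} [Fintype Ω] {N : ℕ} (F : (Fin (N + 1) → Ω) → ℝ) :
    𝔼 ξ, F ξ = 𝔼 a, 𝔼 ξ : Fin N → Ω, F (Fin.cons a ξ) := by
  rw [← Finset.expect_product', Finset.univ_product_univ]
  exact (Fintype.expect_equiv (Fin.consEquiv fun _ => Ω) _ _ fun x => rfl).symm

/-- Conditions on the first sample: once `a` is used, the rest is the same kind of recursion from a
new starting point, with one step less. -/
theorem fin_induction_cons {Ω X : Type*} {N : ℕ} (step : Fin (N + 1) → Ω → X → X) (x : X) (a : Ω)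
    (ξ : Fin N → Ω) (k : Fin (N + 1)) :
    Fin.induction (motive := fun _ => X) x
        (fun j y => step j ((Fin.cons a ξ : Fin (N + 1) → Ω) j) y) k.succ =
      Fin.induction (motive := fun _ => X) (step 0 a x) (fun j y => step j.succ (ξ j) y) k := by
  induction k using Fin.induction with
  | zero => rfl
  | succ k ih =>
    rw [Fin.induction_succ, Fin.induction_succ, ← ih]
    rfl

/-- A random recursion along which the potential `V` decreases in the mean by at least the
reward `g` in every step: the mean total reward is at most the total decrease of `V`. -/
theorem expect_reward_le {Ω X : Type*} [Fintype Ω] [Nonempty Ω] {N : ℕ}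
    (step : Fin N → Ω → X → X) (V : Fin (N + 1) → X → ℝ) (g : Fin N → Ω → X → ℝ)
    (h : ∀ j x, 𝔼 a, (V j.succ (step j a x) + g j a x) ≤ V j.castSucc x) (x : X) :
    𝔼 ξ : Fin N → Ω,
      (V (Fin.last N) (Fin.induction (motive := fun _ => X) x (fun j y => step j (ξ j) y)
          (Fin.last N)) +
        ∑ j, g j (ξ j) (Fin.induction (motive := fun _ => X) x (fun j y => step j (ξ j) y)
          j.castSucc)) ≤ V 0 x := by
  induction N generalizing x with
  | zero => simp
  | succ N ih =>
    rw [expect_fin_cons]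
    refine le_trans (Finset.expect_le_expect fun a _ => ?_) (h 0 x)
    have key := ih (fun j => step j.succ) (fun j => V j.succ) (fun j => g j.succ)
      (fun j y => h j.succ y) (step 0 a x)
    calc _ = 𝔼 ξ : Fin N → Ω, ((V (Fin.last N).succ (Fin.induction (motive := fun _ => X)
            (step 0 a x) (fun j y => step j.succ (ξ j) y) (Fin.last N)) +
            ∑ j, g j.succ (ξ j) (Fin.induction (motive := fun _ => X) (step 0 a x)
              (fun j y => step j.succ (ξ j) y) j.castSucc)) + g 0 a x) := by
          refine Finset.expect_congr rfl fun ξ _ => ?_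
          rw [Fin.sum_univ_succ, ← Fin.succ_last, fin_induction_cons]
          simp only [← Fin.succ_castSucc, fin_induction_cons, Fin.cons_succ, Fin.cons_zero,
            Fin.castSucc_zero, Fin.induction_zero]
          ring
      _ ≤ _ := by
          rw [Finset.expect_add_distrib, Fintype.expect_const]
          exact add_le_add_left key _

variable {E : Type*} [NormedAddCommGroup E] [InnerProductSpace ℝ E]

/-- Centring subtracts `n ‖μ‖²` from the sum of squares, where `μ` is the mean. -/
theorem sum_norm_sub_mean_sq_le {n : ℕ} (h : Fin n → E) :
    ∑ i, ‖h i - (1 / (n : ℝ)) • ∑ j, h j‖ ^ 2 ≤ ∑ i, ‖h i‖ ^ 2 := by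
  rcases Nat.eq_zero_or_pos n with rfl | hn
  · simp
  have hn' : (0 : ℝ) < n := by exact_mod_cast hn
  set μ := (1 / (n : ℝ)) • ∑ j, h j with hμ
  have hs : ∑ j, h j = (n : ℝ) • μ := by rw [hμ, smul_smul]; field_simp; simp
  have : ∑ i, ‖h i - μ‖ ^ 2 = ∑ i, ‖h i‖ ^ 2 - n * ‖μ‖ ^ 2 := by
    simp only [norm_sub_sq_real, Finset.sum_add_distrib, Finset.sum_sub_distrib]
    rw [← Finset.mul_sum, ← sum_inner, hs, inner_smul_left, real_inner_self_eq_norm_sq]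
    simp
    ring
  rw [this]
  have := mul_nonneg hn'.le (sq_nonneg ‖μ‖)
  linarith

/-- A linear functional of a sum of independent centred vectors has mean zero. -/
theorem expect_inner_sum_eq_zero {n : ℕ} (Z : Fin n → E) (hZ : ∑ i, Z i = 0) (B : ℕ) (v : E) :
    𝔼 b : Fin B → Fin n, inner ℝ v (∑ j, Z (b j)) = 0 := by
  induction B with
  | zero => simp
  | succ B ih =>
    rw [expect_fin_cons]
    simp only [Fin.sum_univ_succ, Fin.cons_zero, Fin.cons_succ, inner_add_right,
      Finset.expect_add_distrib, ih, add_zero]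
    rcases Nat.eq_zero_or_pos n with rfl | hn
    · simp
    have : NeZero n := ⟨hn.ne'⟩
    simp only [Fintype.expect_const]
    rw [Fintype.expect_eq_sum_div_card, ← inner_sum, hZ]
    simp

/-- The variance of a sum of independent centred vectors. -/
theorem expect_norm_sum_sq {n : ℕ} (Z : Fin n → E) (hZ : ∑ i, Z i = 0) (B : ℕ) :
    𝔼 b : Fin B → Fin n, ‖∑ j, Z (b j)‖ ^ 2 = B * 𝔼 i, ‖Z i‖ ^ 2 := by
  induction B with
  | zero => simp
  | succ B ih =>
    rw [expect_fin_cons]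
    rcases Nat.eq_zero_or_pos n with rfl | hn
    · simp
    have : NeZero n := ⟨hn.ne'⟩
    simp only [Fin.sum_univ_succ, Fin.cons_zero, Fin.cons_succ, norm_add_sq_real,
      Finset.expect_add_distrib, Fintype.expect_const, ih, ← Finset.mul_expect,
      expect_inner_sum_eq_zero Z hZ]
    push_cast
    ring

/-- One step of a descent method whose direction `P (u + ξ)` is perturbed by the error `ξ` of a
mini-batch average. -/
theorem expect_le_of_minibatch {n B : ℕ} (hn : 1 ≤ n) (hB : 1 ≤ B) (P : E →ₗ[ℝ] E) (u : E)
    {ν τ C a₀ δ : ℝ} (hν : 0 < ν) (hτ : 0 ≤ τ) (hC : 0 ≤ C)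
    (hP : ∀ w, ν * ‖P w‖ ^ 2 ≤ inner ℝ w (P w))
    (h : Fin n → E) (hh : ∀ i, ‖h i‖ ≤ δ)
    (φ : (Fin B → Fin n) → ℝ)
    (hφ : ∀ b, ∀ G, G = u - (1 / (n : ℝ)) • ∑ i, h i + (1 / (B : ℝ)) • ∑ j, h (b j) →
      φ b ≤ a₀ - τ * inner ℝ u (P G) + C * ‖P G‖ ^ 2) :
    𝔼 b, φ b ≤ a₀ - (τ * ν - C) * ‖P u‖ ^ 2 + C * (δ ^ 2 / (ν ^ 2 * B)) := by
  have hn' : (0 : ℝ) < n := by exact_mod_cast hn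
  have hB' : (0 : ℝ) < B := by exact_mod_cast hB
  have : NeZero n := ⟨by omega⟩
  set μ := (1 / (n : ℝ)) • ∑ i, h i with hμ
  set Z : Fin n → E := fun i => h i - μ with hZd
  have hZ : ∑ i, Z i = 0 := by
    simp only [hZd, Finset.sum_sub_distrib, Finset.sum_const, Finset.card_univ, Fintype.card_fin]
    rw [hμ, ← Nat.cast_smul_eq_nsmul ℝ, smul_smul]
    field_simp
    simp
  -- Coercivity and Cauchy-Schwarz: `ν ‖P w‖² ≤ ⟨w, P w⟩ ≤ ‖w‖ ‖P w‖`.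
  have hPn : ∀ w, ‖P w‖ ≤ ‖w‖ / ν := fun w => by
    rw [le_div_iff₀ hν]
    rcases (norm_nonneg (P w)).eq_or_lt with h0 | h0
    · rw [← h0]; simp
    · have := (hP w).trans (real_inner_le_norm w (P w))
      nlinarith
  set e : (Fin B → Fin n) → E := fun b => (1 / (B : ℝ)) • ∑ j, Z (b j) with he
  have hG : ∀ b : Fin B → Fin n, u - μ + (1 / (B : ℝ)) • ∑ j, h (b j) = u + e b := fun b => by
    simp only [he, hZd, Finset.sum_sub_distrib, Finset.sum_const, Finset.card_univ,
      Fintype.card_fin, smul_sub]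
    rw [← Nat.cast_smul_eq_nsmul ℝ, smul_smul, one_div_mul_cancel hB'.ne', one_smul]
    abel
  have hPe : ∀ b, P (e b) = ∑ j, ((1 / (B : ℝ)) • P (Z (b j))) := fun b => by
    simp [he, Finset.smul_sum, map_sum]
  -- Linearity of `P` keeps the error unbiased, so both terms linear in `e b` drop out of the mean
  -- below.
  have hmean : ∀ v, 𝔼 b, inner ℝ v (P (e b)) = 0 := fun v => by
    simp only [hPe]
    exact expect_inner_sum_eq_zero (fun i => (1 / (B : ℝ)) • P (Z i))
      (by rw [← Finset.smul_sum, ← map_sum, hZ]; simp) B v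
  have hδ : 𝔼 i, ‖Z i‖ ^ 2 ≤ δ ^ 2 := by
    rw [Fintype.expect_eq_sum_div_card, Fintype.card_fin, div_le_iff₀ hn']
    refine (sum_norm_sub_mean_sq_le h).trans ?_
    refine (Finset.sum_le_card_nsmul _ _ (δ ^ 2) fun i _ => ?_).trans (le_of_eq ?_)
    · exact pow_le_pow_left₀ (norm_nonneg _) (hh i) 2
    · simp; ring
  have hvar : 𝔼 b, ‖P (e b)‖ ^ 2 ≤ δ ^ 2 / (ν ^ 2 * B) := by
    calc 𝔼 b, ‖P (e b)‖ ^ 2 ≤ 𝔼 b : Fin B → Fin n, (1 / (ν ^ 2 * B ^ 2)) * ‖∑ j, Z (b j)‖ ^ 2 := by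
          refine Finset.expect_le_expect fun b _ => ?_
          refine (pow_le_pow_left₀ (norm_nonneg _) (hPn _) 2).trans (le_of_eq ?_)
          simp only [he, norm_smul, Real.norm_eq_abs, abs_of_pos (one_div_pos.2 hB')]
          field_simp
      _ = (1 / (ν ^ 2 * B ^ 2)) * (B * 𝔼 i, ‖Z i‖ ^ 2) := by
          rw [← Finset.mul_expect, expect_norm_sum_sq Z hZ]
      _ ≤ (1 / (ν ^ 2 * B ^ 2)) * (B * δ ^ 2) := by gcongr
      _ = _ := by field_simp
  calc 𝔼 b, φ b ≤ 𝔼 b, ((a₀ - τ * inner ℝ u (P u) + C * ‖P u‖ ^ 2)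
        + (-τ) * inner ℝ u (P (e b)) + (2 * C) * inner ℝ (P u) (P (e b))
        + C * ‖P (e b)‖ ^ 2) := by
        refine Finset.expect_le_expect fun b _ => ?_
        refine (hφ b (u + e b) (hG b).symm).trans (le_of_eq ?_)
        rw [map_add, inner_add_right, norm_add_sq_real]
        ring
    _ = (a₀ - τ * inner ℝ u (P u) + C * ‖P u‖ ^ 2) + C * 𝔼 b, ‖P (e b)‖ ^ 2 := by
        simp only [Finset.expect_add_distrib, Fintype.expect_const, ← Finset.mul_expect, hmean,
          mul_zero, add_zero]
    _ ≤ _ := by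
        have h1 := mul_le_mul_of_nonneg_left (hP u) hτ
        have h2 := mul_le_mul_of_nonneg_left hvar hC
        linarith

/-- Marginalization: the mean of a function of one of finitely many independent choices. -/
theorem sum_prod_mul_apply {ι κ : Type*} [Fintype ι] [DecidableEq ι] [Fintype κ] (p : κ → ℝ)
    (hp : ∑ k, p k = 1) (i : ι) (φ : κ → ℝ) :
    ∑ σ : ι → κ, (∏ j, p (σ j)) * φ (σ i) = ∑ k, p k * φ k := by
  -- Expanding a product of sums whose `i`-th factor alone carries `φ`; every other factor sums to
  -- one.
  have h := Finset.prod_univ_sum (fun _ : ι => (Finset.univ : Finset κ))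
    (fun j k => p k * if j = i then φ k else 1)
  rw [Fintype.piFinset_univ] at h
  simp only [Finset.prod_mul_distrib, Finset.prod_ite_eq', Finset.mem_univ, if_true] at h
  rw [← h, ← Finset.mul_prod_erase _ _ (Finset.mem_univ i), Finset.prod_eq_one]
  · simp
  · intro j hj
    simp [Finset.ne_of_mem_erase hj, hp]

end Averages

/-! ### Values, oracle counts and expectations of the algorithm. -/

section Counting

namespace Counted

theorem bind_ifo {α β : Type*} (p : Counted α) (q : α → Counted β) :
    (p.bind q).ifo = p.ifo + (q p.val).ifo := rfl

theorem bind_ro {α β : Type*} (p : Counted α) (q : α → Counted β) :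
    (p.bind q).ro = p.ro + (q p.val).ro := rfl

theorem sumList_val {α V : Type*} [AddCommGroup V] (h : α → Counted V) (l : List α) :
    (sumList h l).val = (l.map fun a => (h a).val).sum := by
  induction l with
  | nil => rfl
  | cons a l ih => simp [sumList, bind, pure, ih]

theorem sumList_ifo {α V : Type*} [AddCommGroup V] (h : α → Counted V) {q : ℕ}
    (hq : ∀ a, (h a).ifo = q) (l : List α) : (sumList h l).ifo = l.length * q := by
  induction l with
  | nil => simp [sumList, pure]
  | cons a l ih => simp [sumList, bind, pure, ih, hq]; ring

theorem sumList_ro {α V : Type*} [AddCommGroup V] (h : α → Counted V)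
    (hq : ∀ a, (h a).ro = 0) (l : List α) : (sumList h l).ro = 0 := by
  induction l with
  | nil => simp [sumList, pure]
  | cons a l ih => simp [sumList, bind, pure, ih, hq]

variable {α : Type*} {N : ℕ} (x : α) (q : Fin N → α → Counted α)

theorem induction_val (k : Fin (N + 1)) :
    (Fin.induction (motive := fun _ => Counted α) (pure x) (fun j p => p.bind (q j)) k).val =
      Fin.induction (motive := fun _ => α) x (fun j y => (q j y).val) k := by
  induction k using Fin.induction with
  | zero => rfl
  | succ k ih => rw [Fin.induction_succ, Fin.induction_succ, ← ih]; rfl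

theorem induction_ifo {c : ℕ} (hc : ∀ j y, (q j y).ifo = c) (k : Fin (N + 1)) :
    (Fin.induction (motive := fun _ => Counted α) (pure x) (fun j p => p.bind (q j)) k).ifo =
      k * c := by
  induction k using Fin.induction with
  | zero => simp [pure]
  | succ k ih =>
    rw [Fin.induction_succ, bind_ifo, ih, hc, Fin.val_castSucc, Fin.val_succ]
    ring

theorem induction_ro {c : ℕ} (hc : ∀ j y, (q j y).ro = c) (k : Fin (N + 1)) :
    (Fin.induction (motive := fun _ => Counted α) (pure x) (fun j p => p.bind (q j)) k).ro =
      k * c := by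
  induction k using Fin.induction with
  | zero => simp [pure]
  | succ k ih =>
    rw [Fin.induction_succ, bind_ro, ih, hc, Fin.val_castSucc, Fin.val_succ]
    ring

end Counted

variable {d r n : ℕ} {M : Type*} (emb : M → Mat d r) (f : Fin n → Mat d r → ℝ)

/-- The Euclidean gradient of the objective. -/
def meanGradient (x : M) : Mat d r := (1 / (n : ℝ)) • ∑ i, gradient (f i) (emb x)

theorem fullGradient_val (x : M) : (fullGradient emb f x).val = meanGradient emb f x := by
  simp only [fullGradient, Counted.bind, Counted.pure, Counted.sumList_val, gradCall, meanGradient]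
  rw [← List.ofFn_eq_map, List.sum_ofFn]

theorem fullGradient_ifo (x : M) : (fullGradient emb f x).ifo = n := by
  simp [fullGradient, Counted.bind, Counted.pure,
    Counted.sumList_ifo (gradCall emb f x) (q := 1) (fun _ => rfl)]

theorem fullGradient_ro (x : M) : (fullGradient emb f x).ro = 0 := by
  simp [fullGradient, Counted.bind, Counted.pure,
    Counted.sumList_ro (gradCall emb f x) (fun _ => rfl)]

section

variable {B : ℕ} (x₀ : M) (G₀ : Mat d r) (b : Fin B → Fin n) (x : M)

theorem stochasticGradient_val : (stochasticGradient emb f x₀ G₀ b x).val =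
    G₀ + (1 / (B : ℝ)) • ∑ j, (gradient (f (b j)) (emb x) - gradient (f (b j)) (emb x₀)) := by
  simp only [stochasticGradient, Counted.bind, Counted.pure, Counted.sumList_val, gradCall]
  rw [List.map_ofFn, List.sum_ofFn]
  rfl

theorem stochasticGradient_ifo : (stochasticGradient emb f x₀ G₀ b x).ifo = B * 2 := by
  simp only [stochasticGradient, Counted.bind, Counted.pure]
  rw [Counted.sumList_ifo _ (q := 2) (fun _ => rfl)]
  simp

theorem stochasticGradient_ro : (stochasticGradient emb f x₀ G₀ b x).ro = 0 := by
  simp only [stochasticGradient, Counted.bind, Counted.pure]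
  rw [Counted.sumList_ro _ (fun _ => rfl)]

end

variable {m B K S : ℕ} [TopologicalSpace M] [ChartedSpace (EuclideanSpace ℝ (Fin m)) M]
  [RiemannianBundle (fun x : M => TangentSpace (𝓡 m) x)]
  (R : (x : M) → TangentSpace (𝓡 m) x → M)

theorem innerStep_ifo (τ : ℝ) (x₀ : M) (G₀ : Mat d r) (b : Fin B → Fin n) (x : M) :
    (innerStep emb f R τ x₀ G₀ b x).ifo = B * 2 := by
  simp [innerStep, Counted.bind, stochasticGradient_ifo, retractionCall]

theorem innerStep_ro (τ : ℝ) (x₀ : M) (G₀ : Mat d r) (b : Fin B → Fin n) (x : M) :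
    (innerStep emb f R τ x₀ G₀ b x).ro = 1 := by
  simp [innerStep, Counted.bind, stochasticGradient_ro, retractionCall]

theorem epoch_val (τ : ℝ) (ξ : Fin K → Fin B → Fin n) (x₀ : M) (k : Fin (K + 1)) :
    (epoch emb f R τ ξ x₀ k).val = Fin.induction (motive := fun _ => M) x₀
      (fun j x => (innerStep emb f R τ x₀ (meanGradient emb f x₀) (ξ j) x).val) k := by
  rw [← fullGradient_val]
  exact Counted.induction_val _ _ k

theorem epoch_ifo (τ : ℝ) (ξ : Fin K → Fin B → Fin n) (x₀ : M) (k : Fin (K + 1)) :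
    (epoch emb f R τ ξ x₀ k).ifo = n + k * (B * 2) := by
  simp only [epoch, Counted.bind]
  rw [fullGradient_ifo]
  congr 1
  exact Counted.induction_ifo _ _ (fun j y => innerStep_ifo emb f R τ x₀ _ (ξ j) y) k

theorem epoch_ro (τ : ℝ) (ξ : Fin K → Fin B → Fin n) (x₀ : M) (k : Fin (K + 1)) :
    (epoch emb f R τ ξ x₀ k).ro = k := by
  simp only [epoch, Counted.bind]
  rw [fullGradient_ro, zero_add]
  exact (Counted.induction_ro _ _ (fun j y => innerStep_ro emb f R τ x₀ _ (ξ j) y) k).trans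
    (mul_one _)

theorem epochs_val (τ : Fin S → ℝ) (ξ : Fin S → Fin K → Fin B → Fin n) (x₀ : M)
    (s : Fin (S + 1)) :
    (epochs emb f R τ ξ x₀ s).val = Fin.induction (motive := fun _ => M) x₀
      (fun j x => (epoch emb f R (τ j) (ξ j) x (Fin.last K)).val) s :=
  Counted.induction_val _ _ s

theorem run_ifo (τ : Fin S → ℝ) (x₀ : M) (σ : Seed n B K S) :
    (run emb f R τ x₀ σ).ifo = S * (n + K * (B * 2)) := by
  simp only [run, Counted.bind, Counted.pure, add_zero]
  exact Counted.induction_ifo _ _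
    (fun j y => epoch_ifo emb f R (τ j) (σ.1 j) y (Fin.last K)) (Fin.last S)

theorem run_ro (τ : Fin S → ℝ) (x₀ : M) (σ : Seed n B K S) :
    (run emb f R τ x₀ σ).ro = S * K := by
  simp only [run, Counted.bind, Counted.pure, add_zero]
  exact Counted.induction_ro _ _
    (fun j y => epoch_ro emb f R (τ j) (σ.1 j) y (Fin.last K)) (Fin.last S)

theorem run_val (τ : Fin S → ℝ) (x₀ : M) (σ : Seed n B K S) :
    (run emb f R τ x₀ σ).val = (epoch emb f R (τ σ.2.2) (σ.1 σ.2.2)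
      (epochs emb f R τ σ.1 x₀ σ.2.2.castSucc).val (σ.2.1 σ.2.2)).val := rfl

/-- The expectation over all random choices, with the selections integrated out. -/
theorem expectation_eq (hn : 1 ≤ n) (p : Fin (K + 1) → ℝ) (hp : ∑ k, p k = 1)
    (φ : (Fin S → Fin K → Fin B → Fin n) → Fin S → Fin (K + 1) → ℝ) :
    expectation (fun _ : Fin S => p) (fun σ : Seed n B K S => φ σ.1 σ.2.2 (σ.2.1 σ.2.2)) =
      (1 / (S : ℝ)) * Finset.expect Finset.univ fun ξ : Fin S → Fin K → Fin B → Fin n =>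
        ∑ s, ∑ k, p k * φ ξ s k := by
  have hc : ((Fintype.card (Fin S → Fin K → Fin B → Fin n) : ℕ) : ℝ) ≠ 0 := by
    simp; intro h; omega
  simp only [expectation, seedProb]
  rw [Fintype.sum_prod_type, Fintype.expect_eq_sum_div_card, Finset.sum_div, Finset.mul_sum]
  refine Finset.sum_congr rfl fun ξ _ => ?_
  rw [Fintype.sum_prod_type, Finset.sum_comm, Finset.sum_div, Finset.mul_sum]
  refine Finset.sum_congr rfl fun s _ => ?_
  rw [← sum_prod_mul_apply p hp s, Finset.sum_div, Finset.mul_sum]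
  refine Finset.sum_congr rfl fun σ _ => ?_
  simp
  ring

end Counting

/-! ### The tangent map and one inner iteration. -/

section

variable {d r m n : ℕ} {M : Type*} [TopologicalSpace M] [ChartedSpace (EuclideanSpace ℝ (Fin m)) M]
  [RiemannianBundle (fun x : M => TangentSpace (𝓡 m) x)]

theorem toTangent_add (emb : M → Mat d r) (x : M) (G H : Mat d r) :
    toTangent (m := m) emb x (G + H) = toTangent emb x G + toTangent emb x H := by
  refine ext_inner_right ℝ fun v => ?_
  rw [inner_add_left, inner_toTangent, inner_toTangent, inner_toTangent, inner_add_left]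

theorem toTangent_smul (emb : M → Mat d r) (x : M) (c : ℝ) (G : Mat d r) :
    toTangent (m := m) emb x (c • G) = c • toTangent emb x G := by
  refine ext_inner_right ℝ fun v => ?_
  rw [inner_smul_left, inner_toTangent, inner_toTangent, inner_smul_left]

/-- The linear map that sends a Euclidean vector to its Riemannian counterpart, seen as a
matrix. -/
def tangentMap (m : ℕ) {d r : ℕ} {M : Type*} [TopologicalSpace M]
    [ChartedSpace (EuclideanSpace ℝ (Fin m)) M]
    [RiemannianBundle (fun x : M => TangentSpace (𝓡 m) x)] (emb : M → Mat d r) (x : M) :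
    Mat d r →ₗ[ℝ] Mat d r where
  toFun G := tangentMat emb x (toTangent (m := m) emb x G)
  map_add' G H := by rw [toTangent_add]; exact map_add _ _ _
  map_smul' c G := by rw [toTangent_smul]; exact map_smul _ _ _

theorem MetricEquivalent.le_inner_tangentMap {emb : M → Mat d r} {ν γ : ℝ}
    (h : MetricEquivalent m emb ν γ) (x : M) (w : Mat d r) :
    ν * ‖tangentMap m emb x w‖ ^ 2 ≤ inner ℝ w (tangentMap m emb x w) :=
  ((h x (toTangent emb x w)).1).trans_eq (inner_toTangent emb x w _)

/-- The Riemannian gradient belongs to the Euclidean one. -/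
theorem riemannianGrad_objective {emb : M → Mat d r} {f : Fin n → Mat d r → ℝ} {L : ℝ}
    (hemb : IsSubmanifold m emb) (hf : LipschitzGradients emb f L) (x : M) :
    riemannianGrad (m := m) (objective emb f) x = toTangent emb x (meanGradient emb f x) := by
  have he : MDifferentiableAt (𝓡 m) 𝓘(ℝ, Mat d r) emb x :=
    hemb.smooth.mdifferentiable (by simp) x
  have hg : HasFDerivAt (fun y : Mat d r => (1 / (n : ℝ)) * ∑ i, f i y)
      (innerSL ℝ (meanGradient emb f x)) (emb x) := by
    have h1 : HasFDerivAt (fun y : Mat d r => ∑ i, f i y)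
        (∑ i, innerSL ℝ (gradient (f i) (emb x))) (emb x) := by
      refine HasFDerivAt.fun_sum fun i _ => ?_
      exact ((hf i).1 x).hasGradientAt.hasFDerivAt
    refine (h1.const_mul (1 / (n : ℝ))).congr_fderiv ?_
    ext v
    simp [meanGradient]
  have hd := hg.hasMFDerivAt.comp x he.hasMFDerivAt
  exact congrArg (riesz x) hd.mfderiv

/-- Young's inequality. A plain factor 2 would compound exponentially over an epoch; with `β = c/K`
the factor `(1 + β)^K` stays bounded. -/
theorem norm_add_sq_le_weighted {E : Type*} [NormedAddCommGroup E] [InnerProductSpace ℝ E]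
    (u v : E) {β : ℝ} (hβ : 0 < β) :
    ‖u + v‖ ^ 2 ≤ (1 + β) * ‖u‖ ^ 2 + (1 + β⁻¹) * ‖v‖ ^ 2 := by
  have h1 : ‖u + v‖ ^ 2 ≤ (‖u‖ + ‖v‖) ^ 2 :=
    pow_le_pow_left₀ (norm_nonneg _) (norm_add_le u v) 2
  have h2 : 0 ≤ β * (‖u‖ - β⁻¹ * ‖v‖) ^ 2 := by positivity
  have h3 : β * (‖u‖ - β⁻¹ * ‖v‖) ^ 2 = β * ‖u‖ ^ 2 - 2 * ‖u‖ * ‖v‖ + β⁻¹ * ‖v‖ ^ 2 := by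
    field_simp
    ring
  nlinarith

variable {B : ℕ} {emb : M → Mat d r} {f : Fin n → Mat d r → ℝ}
  {R : (x : M) → TangentSpace (𝓡 m) x → M} {ν γ L L₁ L₂ Lhat T : ℝ}

/-- The mean change of the potential `f + l ‖· - x₀‖²` in one inner iteration. -/
theorem expect_innerStep_le (hn : 1 ≤ n) (hB : 1 ≤ B) (hν : 0 < ν) (hLhat : 0 < Lhat)
    (hemb : IsSubmanifold m emb) (hmet : MetricEquivalent m emb ν γ)
    (hf : LipschitzGradients emb f L) (hR : RetractionBounds emb R L₁ L₂ T)
    (hdesc : DescentInequality emb R (objective emb f) Lhat T)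
    {τ l β : ℝ} (hτ : 0 ≤ τ) (hτT : τ ≤ T) (hl : 0 ≤ l) (hβ : 0 < β) (x₀ x : M) :
    𝔼 b : Fin B → Fin n,
      (objective emb f (innerStep emb f R τ x₀ (meanGradient emb f x₀) b x).val +
        l * ‖emb (innerStep emb f R τ x₀ (meanGradient emb f x₀) b x).val - emb x₀‖ ^ 2) ≤
      objective emb f x +
        (l * (1 + β + (1 + β⁻¹) * (L ^ 2 * L₁ ^ 2 * τ ^ 2 / (ν ^ 2 * B))) +
          Lhat / 2 * τ ^ 2 * (L ^ 2 / (ν ^ 2 * B))) * ‖emb x - emb x₀‖ ^ 2 -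
        (τ * ν - Lhat / 2 * τ ^ 2 - l * ((1 + β⁻¹) * (L₁ ^ 2 * τ ^ 2))) *
          ‖tangentMat emb x (riemannianGrad (m := m) (objective emb f) x)‖ ^ 2 := by
  have hB' : (0 : ℝ) < B := by exact_mod_cast hB
  have hβ' : 0 < β⁻¹ := inv_pos.2 hβ
  rw [riemannianGrad_objective hemb hf]
  -- Total coefficient of the squared step direction: one part from the descent inequality, one from
  -- the penalty.
  set C := Lhat / 2 * τ ^ 2 + l * ((1 + β⁻¹) * (L₁ ^ 2 * τ ^ 2)) with hC
  have hC0 : 0 ≤ C := by positivity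
  refine (expect_le_of_minibatch (C := C) (τ := τ) (ν := ν) (δ := L * ‖emb x - emb x₀‖)
    (a₀ := objective emb f x + l * (1 + β) * ‖emb x - emb x₀‖ ^ 2)
    hn hB (tangentMap m emb x) (meanGradient emb f x) hν hτ hC0
    (hmet.le_inner_tangentMap x)
    (fun i => gradient (f i) (emb x) - gradient (f i) (emb x₀))
    (fun i => (hf i).2 x x₀) _ ?_).trans (le_of_eq ?_)
  · intro b G hG
    have hG' : (stochasticGradient emb f x₀ (meanGradient emb f x₀) b x).val = G := by
      rw [stochasticGradient_val, hG, Finset.sum_sub_distrib (s := Finset.univ (α := Fin n)),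
        smul_sub, meanGradient, meanGradient, sub_sub_cancel]
    -- Written with `τ` as the curve parameter, so that the retraction hypotheses apply with `t = τ
    -- ≤ T`.
    have hx' : (innerStep emb f R τ x₀ (meanGradient emb f x₀) b x).val =
        R x (τ • (-toTangent emb x G)) := by
      rw [smul_neg, ← hG']
      rfl
    rw [hx']
    have hneg : tangentMat emb x (-toTangent (m := m) emb x G) = -tangentMap m emb x G :=
      map_neg _ _
    have h1 := hdesc x (-toTangent emb x G) τ hτ hτT
    have h2 := (hR x (-toTangent emb x G) τ hτ hτT).1
    rw [riemannianGrad_objective hemb hf, inner_toTangent, hneg, norm_neg, inner_neg_right] at h1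
    rw [hneg, norm_neg] at h2
    have h3 := norm_add_sq_le_weighted (emb x - emb x₀)
      (emb (R x (τ • (-toTangent emb x G))) - emb x) hβ
    rw [sub_add_sub_cancel'] at h3
    have h4 : (1 + β⁻¹) * ‖emb (R x (τ • (-toTangent emb x G))) - emb x‖ ^ 2 ≤
        (1 + β⁻¹) * (L₁ ^ 2 * τ ^ 2 * ‖tangentMap m emb x G‖ ^ 2) := by
      refine mul_le_mul_of_nonneg_left ?_ (by positivity)
      refine (pow_le_pow_left₀ (norm_nonneg _) h2 2).trans (le_of_eq (by ring))
    have h5 := mul_le_mul_of_nonneg_left (h3.trans (add_le_add_right h4 _)) hl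
    refine (add_le_add h1 h5).trans (le_of_eq ?_)
    rw [hC]
    ring
  · change _ - _ * ‖tangentMap m emb x (meanGradient emb f x)‖ ^ 2 + _ =
      _ - _ * ‖tangentMap m emb x (meanGradient emb f x)‖ ^ 2
    rw [hC]
    ring

end

/-! ### Telescoping over an epoch and over all epochs. -/

theorem Gam_nonneg {z : ℝ} (hz : 0 < z) (i : ℕ) : 0 ≤ Gam z i :=
  div_nonneg (sub_nonneg.2 (one_le_pow₀ (by linarith))) hz.le

/-- `Γ(z, i + 1)` is the geometric sum of `(1 + z)^j` over `j < i`; this is the recursion solved by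
the penalty weights. -/
theorem Gam_succ_succ {z : ℝ} (hz : 0 < z) (i : ℕ) :
    Gam z (i + 2) = Gam z (i + 1) * (1 + z) + 1 := by
  simp only [Gam, Nat.add_sub_cancel, show i + 2 - 1 = i + 1 from rfl]
  field_simp
  ring

section

variable {d r m n : ℕ} {M : Type*} [TopologicalSpace M] [ChartedSpace (EuclideanSpace ℝ (Fin m)) M]
  [RiemannianBundle (fun x : M => TangentSpace (𝓡 m) x)]
  {B K S : ℕ} {emb : M → Mat d r} {f : Fin n → Mat d r → ℝ}
  {R : (x : M) → TangentSpace (𝓡 m) x → M} {ν γ L L₁ L₂ Lhat T : ℝ}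

/-- The squared Frobenius norm of the Riemannian gradient of the objective. -/
def gradNormSq (m : ℕ) {d r n : ℕ} {M : Type*} [TopologicalSpace M]
    [ChartedSpace (EuclideanSpace ℝ (Fin m)) M]
    [RiemannianBundle (fun x : M => TangentSpace (𝓡 m) x)] (emb : M → Mat d r)
    (f : Fin n → Mat d r → ℝ) (x : M) : ℝ :=
  ‖tangentMat emb x (riemannianGrad (m := m) (objective emb f) x)‖ ^ 2

/-- The mean decrease of the objective over one epoch. -/
theorem expect_epoch_le (hn : 1 ≤ n) (hB : 1 ≤ B) (hν : 0 < ν) (hLhat : 0 < Lhat)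
    (hemb : IsSubmanifold m emb) (hmet : MetricEquivalent m emb ν γ)
    (hf : LipschitzGradients emb f L) (hR : RetractionBounds emb R L₁ L₂ T)
    (hdesc : DescentInequality emb R (objective emb f) Lhat T)
    {τ β : ℝ} (hτ : 0 ≤ τ) (hτT : τ ≤ T) (hβ : 0 < β) (x₀ : M) :
    𝔼 ξ : Fin K → Fin B → Fin n,
      (objective emb f (epoch emb f R τ ξ x₀ (Fin.last K)).val +
        ∑ k : Fin K, Delta ν L L₁ Lhat β τ B K k *
          gradNormSq m emb f (epoch emb f R τ ξ x₀ k.castSucc).val) ≤ objective emb f x₀ := by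
  have : NeZero n := ⟨by omega⟩
  have hB' : (0 : ℝ) < B := by exact_mod_cast hB
  have hβ' : 0 < β⁻¹ := inv_pos.2 hβ
  set a := (1 + β⁻¹) * (L ^ 2 * L₁ ^ 2 * τ ^ 2 / (ν ^ 2 * B)) with ha
  have ha0 : 0 ≤ a := by positivity
  have hz : 0 < β + a := by positivity
  -- The index `K - k + 1` makes `l_K` a multiple of `Γ(z, 1) = 0`, and makes `l_{k+1}` carry the
  -- `Γ(z, K - k)` of `Δ_k`.
  set l : Fin (K + 1) → ℝ := fun k =>
    Lhat / 2 * τ ^ 2 * (L ^ 2 / (ν ^ 2 * B)) * Gam (β + a) (K - k + 1) with hl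
  have hl0 : ∀ k, 0 ≤ l k := fun k => mul_nonneg (by positivity) (Gam_nonneg hz _)
  have key := expect_reward_le
    (fun (_ : Fin K) (b : Fin B → Fin n) x => (innerStep emb f R τ x₀ (meanGradient emb f x₀) b x).val)
    (fun k x => objective emb f x + l k * ‖emb x - emb x₀‖ ^ 2)
    (fun k _ x => Delta ν L L₁ Lhat β τ B K k * gradNormSq m emb f x)
    (fun k x => ?_) x₀
  · simp only [sub_self, norm_zero] at key
    simp only [epoch_val]
    refine le_trans (le_of_eq ?_) (key.trans (le_of_eq (by ring)))
    refine Finset.expect_congr rfl fun ξ _ => ?_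
    simp [hl, Gam]
  · have h := expect_innerStep_le hn hB hν hLhat hemb hmet hf hR hdesc hτ hτT (hl0 k.succ) hβ x₀ x
    rw [Finset.expect_add_distrib, Fintype.expect_const]
    refine (add_le_add_left h _).trans (le_of_eq ?_)
    obtain ⟨i, hi⟩ : ∃ i, K - (k : ℕ) = i + 1 := ⟨K - k - 1, by omega⟩
    have hi' : K - ((k : ℕ) + 1) = i := by omega
    have e1 : l k.castSucc = l k.succ * (1 + β + a) +
        Lhat / 2 * τ ^ 2 * (L ^ 2 / (ν ^ 2 * B)) := by
      simp only [hl, Fin.val_castSucc, Fin.val_succ, hi, hi', Gam_succ_succ hz]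
      ring
    have e2 : Delta ν L L₁ Lhat β τ B K k =
        τ * ν - Lhat / 2 * τ ^ 2 - l k.succ * ((1 + β⁻¹) * (L₁ ^ 2 * τ ^ 2)) := by
      simp only [Delta, hl, Fin.val_succ, hi, hi', ← ha]
      rw [ha]
      ring
    rw [e1, e2, gradNormSq]
    ring

/-- The mean decrease of the objective over all epochs. -/
theorem expect_epochs_le (hn : 1 ≤ n) (hB : 1 ≤ B) (hν : 0 < ν) (hLhat : 0 < Lhat)
    (hemb : IsSubmanifold m emb) (hmet : MetricEquivalent m emb ν γ)
    (hf : LipschitzGradients emb f L) (hR : RetractionBounds emb R L₁ L₂ T)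
    (hdesc : DescentInequality emb R (objective emb f) Lhat T)
    {τ β : ℝ} (hτ : 0 ≤ τ) (hτT : τ ≤ T) (hβ : 0 < β) (x₀ : M) {D : ℝ}
    (hD : ∀ y : M, objective emb f x₀ - objective emb f y ≤ D) :
    𝔼 ξ : Fin S → Fin K → Fin B → Fin n,
      ∑ s, ∑ k : Fin K, Delta ν L L₁ Lhat β τ B K k *
        gradNormSq m emb f (epoch emb f R τ (ξ s)
          (epochs emb f R (fun _ => τ) ξ x₀ s.castSucc).val k.castSucc).val ≤ D := by
  have : NeZero n := ⟨by omega⟩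
  -- Across epochs no penalty is needed: the objective is the potential, and the reward is the
  -- weighted sum of a whole epoch.
  have key := expect_reward_le
    (fun (_ : Fin S) (ξ : Fin K → Fin B → Fin n) x => (epoch emb f R τ ξ x (Fin.last K)).val)
    (fun _ x => objective emb f x)
    (fun _ ξ x => ∑ k : Fin K, Delta ν L L₁ Lhat β τ B K k *
        gradNormSq m emb f (epoch emb f R τ ξ x k.castSucc).val)
    (fun _ x => expect_epoch_le hn hB hν hLhat hemb hmet hf hR hdesc hτ hτT hβ x) x₀
  simp only [epochs_val]
  have h2 : ∀ ξ : Fin S → Fin K → Fin B → Fin n, objective emb f x₀ - D ≤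
      objective emb f (Fin.induction (motive := fun _ => M) x₀
        (fun j y => (epoch emb f R τ (ξ j) y (Fin.last K)).val) (Fin.last S)) := fun ξ => by
    linarith [hD (Fin.induction (motive := fun _ => M) x₀
        (fun j y => (epoch emb f R τ (ξ j) y (Fin.last K)).val) (Fin.last S))]
  have h3 := Finset.expect_le_expect (s := Finset.univ) fun ξ _ => h2 ξ
  rw [Fintype.expect_const] at h3
  rw [Finset.expect_add_distrib] at key
  linarith

/-- The mean squared gradient norm at the returned point. -/
theorem expectation_gradNormSq_le (hn : 1 ≤ n) (hB : 1 ≤ B) (hν : 0 < ν) (hLhat : 0 < Lhat)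
    (hemb : IsSubmanifold m emb) (hmet : MetricEquivalent m emb ν γ)
    (hf : LipschitzGradients emb f L) (hR : RetractionBounds emb R L₁ L₂ T)
    (hdesc : DescentInequality emb R (objective emb f) Lhat T)
    {τ β : ℝ} (hτ : 0 ≤ τ) (hτT : τ ≤ T) (hβ : 0 < β) (x₀ : M) {D : ℝ}
    (hD : ∀ y : M, objective emb f x₀ - objective emb f y ≤ D)
    (hp : ∑ k, selectProb (Delta ν L L₁ Lhat β τ B K) K k = 1)
    (hΔ : 0 < ∑ j ∈ Finset.range K, Delta ν L L₁ Lhat β τ B K j) :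
    expectation (fun _ : Fin S => selectProb (Delta ν L L₁ Lhat β τ B K) K)
      (fun σ : Seed n B K S => gradNormSq m emb f (run emb f R (fun _ => τ) x₀ σ).val) ≤
      D / (S * ∑ j ∈ Finset.range K, Delta ν L L₁ Lhat β τ B K j) := by
  simp only [run_val]
  rw [expectation_eq hn _ hp (fun ξ s k => gradNormSq m emb f (epoch emb f R τ (ξ s)
          (epochs emb f R (fun _ => τ) ξ x₀ s.castSucc).val k).val)]
  have h := expect_epochs_le (S := S) (K := K) hn hB hν hLhat hemb hmet hf hR hdesc hτ hτT hβ x₀ hD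
  set W := ∑ j ∈ Finset.range K, Delta ν L L₁ Lhat β τ B K j
  have e : ∀ g : Fin (K + 1) → ℝ, ∑ k, selectProb (Delta ν L L₁ Lhat β τ B K) K k * g k =
      (1 / W) * ∑ k : Fin K, Delta ν L L₁ Lhat β τ B K k * g k.castSucc := fun g => by
    rw [Fin.sum_univ_castSucc, Finset.mul_sum]
    simp only [selectProb, Fin.val_castSucc, Fin.is_lt, if_true, Fin.val_last, lt_irrefl, if_false,
      zero_mul, add_zero]
    exact Finset.sum_congr rfl fun k _ => by ring
  simp only [e, ← Finset.mul_sum]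
  rw [← Finset.mul_expect, ← mul_assoc]
  refine (mul_le_mul_of_nonneg_left h (by positivity)).trans (le_of_eq ?_)
  rw [one_div_mul_one_div]
  ring

end

/-! ### Lower bound for the weights, and the selection probabilities. -/

/-- From `a ≤ (c + 1) β` follow `K (β + a) ≤ c² + 2c` and `a / (β + a) ≤ (c + 1)/(c + 2)`. Hence the
bracket in `Δ_k` is at most the bracket in `hc`, and with `τ ≤ cν/(L₁L)` the subtracted term is at
most `ν/2`. -/
theorem half_le_Delta {c ν L L₁ Lhat τ β : ℝ} {B K k : ℕ} (hc₀ : 0 < c) (hν : 0 < ν)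
    (hL : 0 < L) (hL₁ : 1 ≤ L₁) (hLhat : 0 < Lhat)
    (hc : Lhat / (L₁ * L) *
      ((c + 1) / (c + 2) * Real.exp (c ^ 2 + 2 * c) + 1 / (c + 2)) * c ≤ 1)
    (hK : 1 ≤ K) (hβ : β = c / K) (hτ₀ : 0 ≤ τ) (hτ : τ ≤ c * ν / (L₁ * L))
    (ha : L ^ 2 * L₁ ^ 2 * τ ^ 2 / (ν ^ 2 * B) ≤ c ^ 2 / K ^ 2) :
    τ * ν / 2 ≤ Delta ν L L₁ Lhat β τ B K k := by
  have hK' : (1 : ℝ) ≤ K := by exact_mod_cast hK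
  have hL₁' : 0 < L₁ := by linarith
  have hβ0 : 0 < β := by rw [hβ]; positivity
  set a := (1 + β⁻¹) * (L ^ 2 * L₁ ^ 2 * τ ^ 2 / (ν ^ 2 * B)) with had
  have ha0 : 0 ≤ a := by positivity
  have ha1 : a ≤ (c + 1) * β := by
    calc a ≤ (1 + β⁻¹) * (c ^ 2 / K ^ 2) := mul_le_mul_of_nonneg_left ha (by positivity)
      _ = c ^ 2 / K ^ 2 + c / K := by rw [hβ]; field_simp
      _ ≤ c ^ 2 / K + c / K := by
          refine add_le_add_left (div_le_div_of_nonneg_left (sq_nonneg c) (by linarith) ?_) _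
          nlinarith
      _ = (c + 1) * β := by rw [hβ]; ring
  have hz : 0 < β + a := by positivity
  have hpow : (1 + (β + a)) ^ (K - k - 1) ≤ Real.exp (c ^ 2 + 2 * c) := by
    calc (1 + (β + a)) ^ (K - k - 1) ≤ (1 + (β + a)) ^ K :=
          pow_le_pow_right₀ (by linarith) (by omega)
      _ ≤ Real.exp (β + a) ^ K := by
          gcongr
          linarith [Real.add_one_le_exp (β + a)]
      _ = Real.exp (K * (β + a)) := (Real.exp_nat_mul _ _).symm
      _ ≤ _ := by
          rw [Real.exp_le_exp]
          calc (K : ℝ) * (β + a) ≤ K * ((c + 2) * β) := by gcongr; linarith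
            _ = c ^ 2 + 2 * c := by rw [hβ]; field_simp
  have hfrac : a / (β + a) ≤ (c + 1) / (c + 2) := by
    rw [div_le_div_iff₀ hz (by linarith)]
    nlinarith
  have hexp : 1 ≤ Real.exp (c ^ 2 + 2 * c) := Real.one_le_exp (by positivity)
  have hQ : 1 + a * Gam (β + a) (K - k) ≤
      (c + 1) / (c + 2) * Real.exp (c ^ 2 + 2 * c) + 1 / (c + 2) := by
    calc 1 + a * Gam (β + a) (K - k)
        = 1 + a / (β + a) * ((1 + (β + a)) ^ (K - k - 1) - 1) := by rw [Gam]; ring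
      _ ≤ 1 + (c + 1) / (c + 2) * (Real.exp (c ^ 2 + 2 * c) - 1) := by
          refine add_le_add_right ?_ _
          refine (mul_le_mul_of_nonneg_left (sub_le_sub_right hpow 1) (by positivity)).trans ?_
          exact mul_le_mul_of_nonneg_right hfrac (by linarith)
      _ = _ := by field_simp; ring
  set Q := (c + 1) / (c + 2) * Real.exp (c ^ 2 + 2 * c) + 1 / (c + 2)
  have hQ0 : 0 ≤ Q := by positivity
  have h1 : Lhat / 2 * τ * (1 + a * Gam (β + a) (K - k)) ≤ ν / 2 := by
    calc _ ≤ Lhat / 2 * (c * ν / (L₁ * L)) * Q := by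
          refine (mul_le_mul_of_nonneg_left hQ (by positivity)).trans ?_
          gcongr
      _ = (Lhat / (L₁ * L) * Q * c) * (ν / 2) := by ring
      _ ≤ 1 * (ν / 2) := by gcongr
      _ = ν / 2 := one_mul _
  have h2 := mul_le_mul_of_nonneg_left h1 hτ₀
  rw [Delta, ← had]
  linarith

theorem selectProb_nonneg {Δ : ℕ → ℝ} {K : ℕ} (h : ∀ k < K, 0 ≤ Δ k) (k : Fin (K + 1)) :
    0 ≤ selectProb Δ K k := by
  unfold selectProb
  split_ifs with hk
  · exact div_nonneg (h k hk) (Finset.sum_nonneg fun j hj => h j (Finset.mem_range.1 hj))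
  · exact le_rfl

theorem sum_selectProb {Δ : ℕ → ℝ} {K : ℕ} (h : 0 < ∑ j ∈ Finset.range K, Δ j) :
    ∑ k, selectProb Δ K k = 1 := by
  rw [Fin.sum_univ_castSucc]
  simp only [selectProb, Fin.val_castSucc, Fin.is_lt, if_true, Fin.val_last, lt_irrefl, if_false,
    add_zero]
  rw [Fin.sum_univ_eq_sum_range (fun k => Δ k / ∑ j ∈ Finset.range K, Δ j), ← Finset.sum_div,
    div_self h.ne']

/-! ### Sizes of the parameters and the total oracle cost. -/

section

variable {θ κ : ℝ} {n : ℕ}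

theorem one_le_innerLength (hκ : 0 < κ) (hn : 1 ≤ n) : 1 ≤ innerLength θ κ n :=
  Nat.ceil_pos.2 (Real.rpow_pos_of_pos (by positivity) _)

theorem innerLength_le (hκ : 0 < κ) (hn : 1 ≤ n) (hθ₁ : θ ≤ 1) :
    (innerLength θ κ n : ℝ) ≤
      (κ ^ (1 / (3 - 2 * θ)) + 1) * (n : ℝ) ^ (1 / (3 - 2 * θ)) := by
  have hn' : (1 : ℝ) ≤ n := by exact_mod_cast hn
  have h0 : 0 ≤ 1 / (3 - 2 * θ) := by
    apply one_div_nonneg.2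
    linarith
  refine (Nat.ceil_lt_add_one (by positivity)).le.trans ?_
  rw [Real.mul_rpow hκ.le (by positivity), add_mul, one_mul]
  exact add_le_add_right (Real.one_le_rpow hn' h0) _

theorem one_le_batchSize {K : ℕ} (hK : 1 ≤ K) : 1 ≤ batchSize θ K :=
  Nat.ceil_pos.2 (Real.rpow_pos_of_pos (by positivity) _)

theorem batchSize_le {K : ℕ} (hK : 1 ≤ K) (hθ₁ : θ ≤ 1) :
    (batchSize θ K : ℝ) ≤ 2 * (K : ℝ) ^ (2 - 2 * θ) := by
  have hK' : (1 : ℝ) ≤ K := by exact_mod_cast hK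
  have := Real.one_le_rpow hK' (show 0 ≤ 2 - 2 * θ by linarith)
  have h2 := (Nat.ceil_lt_add_one (show 0 ≤ (K : ℝ) ^ (2 - 2 * θ) by positivity)).le
  unfold batchSize
  linarith

/-- Bounds for the oracle calls of `S` epochs, if `S` is at most `G / (K^{1-θ} ε) + 2`. -/
theorem exists_cost_bound (hθ₀ : 0 ≤ θ) (hθ₁ : θ ≤ 1) (hκ : 0 < κ) {G : ℝ} (hG : 0 ≤ G) :
    ∃ C : ℝ, 0 < C ∧ ∀ (n : ℕ) (ε : ℝ) (K B S : ℕ), 1 ≤ n → 0 < ε → K = innerLength θ κ n →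
      B = batchSize θ K → (S : ℝ) ≤ G / ((K : ℝ) ^ (1 - θ) * ε) + 2 →
      (S : ℝ) * (n + K * (B * 2)) ≤ C * ((n : ℝ) ^ ((2 - θ) / (3 - 2 * θ)) / ε + n) ∧
      (S : ℝ) * K ≤ C * ((n : ℝ) ^ (θ / (3 - 2 * θ)) / ε + (n : ℝ) ^ (1 / (3 - 2 * θ))) := by
  have h3 : 0 < 3 - 2 * θ := by linarith
  set e := 1 / (3 - 2 * θ) with he
  set A := κ ^ e + 1 with hA
  have hA0 : 0 < A := by positivity
  set A₂ := 1 + 4 * A ^ (3 - 2 * θ) with hA₂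
  have hA₂0 : 0 < A₂ := by positivity
  set κ' := κ ^ (-(e * (1 - θ))) with hκ'
  have hκ0 : 0 < κ' := by positivity
  refine ⟨2 * A₂ + A₂ * G * κ' + 2 * A + G * A ^ θ, by positivity, ?_⟩
  intro n ε K B S hn hε hK hB hS
  have hn' : (1 : ℝ) ≤ n := by exact_mod_cast hn
  have hn0 : (0 : ℝ) < n := by linarith
  have hK1 : 1 ≤ K := hK ▸ one_le_innerLength hκ hn
  have hK0 : (0 : ℝ) < K := by exact_mod_cast hK1
  have hKle : (K : ℝ) ≤ A * (n : ℝ) ^ e := hK ▸ innerLength_le hκ hn hθ₁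
  have hKge : (κ * n) ^ e ≤ (K : ℝ) := hK ▸ Nat.le_ceil _
  have hBle : (B : ℝ) ≤ 2 * (K : ℝ) ^ (2 - 2 * θ) := hB ▸ batchSize_le hK1 hθ₁
  -- The exponents of `K` and `|B|` add up to `3 - 2θ`, so the inner loop costs no more than a full
  -- gradient, up to a constant.
  have hKB : (K : ℝ) * B ≤ 2 * (A ^ (3 - 2 * θ) * n) := by
    calc (K : ℝ) * B ≤ K * (2 * (K : ℝ) ^ (2 - 2 * θ)) := by gcongr
      _ = 2 * (K : ℝ) ^ (3 - 2 * θ) := by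
          rw [show 3 - 2 * θ = 1 + (2 - 2 * θ) by ring, Real.rpow_add hK0, Real.rpow_one]
          ring
      _ ≤ 2 * (A * (n : ℝ) ^ e) ^ (3 - 2 * θ) := by gcongr
      _ = _ := by
          rw [Real.mul_rpow hA0.le (by positivity), ← Real.rpow_mul hn0.le, he,
            one_div_mul_cancel h3.ne', Real.rpow_one]
  have hcost : (n : ℝ) + K * (B * 2) ≤ A₂ * n := by rw [hA₂]; linarith
  -- Here `K` is needed from below; the exponent is `1 - (1 - θ)/(3 - 2θ)`.
  have hnK : (n : ℝ) / (K : ℝ) ^ (1 - θ) ≤ κ' * (n : ℝ) ^ ((2 - θ) / (3 - 2 * θ)) := by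
    have h1 : ((κ * n) ^ e) ^ (1 - θ) ≤ (K : ℝ) ^ (1 - θ) :=
      Real.rpow_le_rpow (by positivity) hKge (by linarith)
    refine (div_le_div_of_nonneg_left hn0.le (by positivity) h1).trans (le_of_eq ?_)
    rw [← Real.rpow_mul (by positivity), Real.mul_rpow hκ.le hn0.le, hκ', Real.rpow_neg hκ.le,
      show (2 - θ) / (3 - 2 * θ) = 1 - e * (1 - θ) by rw [he]; field_simp; ring,
      Real.rpow_sub hn0, Real.rpow_one]
    field_simp
  have hKθ : (K : ℝ) / (K : ℝ) ^ (1 - θ) ≤ A ^ θ * (n : ℝ) ^ (θ / (3 - 2 * θ)) := by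
    calc (K : ℝ) / (K : ℝ) ^ (1 - θ) = (K : ℝ) ^ θ := by
          rw [Real.rpow_sub hK0, Real.rpow_one]
          field_simp
      _ ≤ (A * (n : ℝ) ^ e) ^ θ := by gcongr
      _ = _ := by
          rw [Real.mul_rpow hA0.le (by positivity), ← Real.rpow_mul hn0.le, he]
          congr 2
          ring
  have hKp : 0 < (K : ℝ) ^ (1 - θ) := by positivity
  set N₁ := (n : ℝ) ^ ((2 - θ) / (3 - 2 * θ))
  set N₂ := (n : ℝ) ^ (θ / (3 - 2 * θ))
  set N₃ := (n : ℝ) ^ e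
  have hN₁ : 0 ≤ N₁ / ε := by positivity
  have hN₂ : 0 ≤ N₂ / ε := by positivity
  have hN₃ : 0 ≤ N₃ := by positivity
  have q1 : 0 ≤ A₂ * G * κ' := by positivity
  have q2 : 0 ≤ G * A ^ θ := by positivity
  constructor
  · calc (S : ℝ) * (n + K * (B * 2)) ≤ (G / ((K : ℝ) ^ (1 - θ) * ε) + 2) * (A₂ * n) := by gcongr
      _ = A₂ * G / ε * (n / (K : ℝ) ^ (1 - θ)) + 2 * A₂ * n := by field_simp
      _ ≤ A₂ * G / ε * (κ' * N₁) + 2 * A₂ * n := by gcongr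
      _ = A₂ * G * κ' * (N₁ / ε) + 2 * A₂ * n := by ring
      _ ≤ (2 * A₂ + A₂ * G * κ' + 2 * A + G * A ^ θ) * (N₁ / ε) +
          (2 * A₂ + A₂ * G * κ' + 2 * A + G * A ^ θ) * n := by gcongr <;> linarith
      _ = _ := by ring
  · calc (S : ℝ) * K ≤ (G / ((K : ℝ) ^ (1 - θ) * ε) + 2) * K := by gcongr
      _ = G / ε * (K / (K : ℝ) ^ (1 - θ)) + 2 * K := by field_simp
      _ ≤ G / ε * (A ^ θ * N₂) + 2 * (A * N₃) := by gcongr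
      _ = G * A ^ θ * (N₂ / ε) + 2 * A * N₃ := by ring
      _ ≤ (2 * A₂ + A₂ * G * κ' + 2 * A + G * A ^ θ) * (N₂ / ε) +
          (2 * A₂ + A₂ * G * κ' + 2 * A + G * A ^ θ) * N₃ := by gcongr <;> linarith
      _ = _ := by ring

end

theorem stepFactor_pos {c ν L L₁ T : ℝ} (hc₀ : 0 < c) (hν : 0 < ν) (hL : 0 < L) (hL₁ : 1 ≤ L₁)
    (hT : 0 < T) : 0 < stepFactor c ν L₁ L T :=
  lt_min (lt_min (by positivity) one_pos) hT

theorem stepSize_pos {b θ : ℝ} {K : ℕ} (hb : 0 < b) (hK : 1 ≤ K) : 0 < stepSize b θ K :=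
  mul_pos hb (Real.rpow_pos_of_pos (by exact_mod_cast hK) _)

theorem stepSize_le {b θ : ℝ} {K : ℕ} (hb : 0 < b) (hK : 1 ≤ K) (hθ₀ : 0 ≤ θ) :
    stepSize b θ K ≤ b :=
  mul_le_of_le_one_right hb.le
    (Real.rpow_le_one_of_one_le_of_nonpos (by exact_mod_cast hK) (by linarith))

theorem mul_stepSize {b θ : ℝ} {K : ℕ} (hK : 1 ≤ K) :
    K * stepSize b θ K = b * (K : ℝ) ^ (1 - θ) := by
  have hK0 : (0 : ℝ) < K := by exact_mod_cast hK
  rw [stepSize, sub_eq_add_neg, Real.rpow_add hK0, Real.rpow_one]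
  ring

/-- The batch size balances the step size: `τ²` contributes `K^{-2θ}` and `1/|B|` at most
`K^{-(2-2θ)}`, together `K^{-2}` for every `θ`. -/
theorem stepSize_sq_div_batchSize_le {b c ν L L₁ θ : ℝ} {K : ℕ} (hb₀ : 0 < b)
    (hb : b ≤ c * ν / (L₁ * L)) (hν : 0 < ν) (hL : 0 < L) (hL₁ : 1 ≤ L₁) (hK : 1 ≤ K) :
    L ^ 2 * L₁ ^ 2 * stepSize b θ K ^ 2 / (ν ^ 2 * batchSize θ K) ≤ c ^ 2 / K ^ 2 := by
  have hK0 : (0 : ℝ) < K := by exact_mod_cast hK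
  have hB : (K : ℝ) ^ (2 - 2 * θ) ≤ batchSize θ K := Nat.le_ceil _
  have h1 : L * L₁ * b ≤ c * ν := by
    rw [le_div_iff₀ (by positivity)] at hb
    linarith
  calc L ^ 2 * L₁ ^ 2 * stepSize b θ K ^ 2 / (ν ^ 2 * batchSize θ K)
      = (L * L₁ * b) ^ 2 * ((K : ℝ) ^ (-θ)) ^ 2 / (ν ^ 2 * batchSize θ K) := by
        rw [stepSize]
        ring
    _ ≤ (c * ν) ^ 2 * ((K : ℝ) ^ (-θ)) ^ 2 / (ν ^ 2 * (K : ℝ) ^ (2 - 2 * θ)) := by gcongr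
    _ = c ^ 2 / K ^ 2 := by
        rw [← Real.rpow_mul_natCast hK0.le, show 2 - 2 * θ = (2 : ℕ) + -θ * (2 : ℕ) by
          push_cast; ring, Real.rpow_add hK0, Real.rpow_natCast]
        have := Real.rpow_pos_of_pos hK0 (-θ * (2 : ℕ))
        field_simp

end SSVRG

/-! ### The complexity theorem. -/

open SSVRG in
theorem mainTheorem4
    (θ κ c ν L L₁ Lhat T D : ℝ)
    (hθ₀ : 0 ≤ θ) (hθ₁ : θ ≤ 1) (hκ : 0 < κ) (hc₀ : 0 < c) (hc₁ : c < 1) (hν : 0 < ν)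
    (hL : 0 < L) (hL₁ : 1 ≤ L₁) (hLhat : 0 < Lhat) (hT : 0 < T)
    (hc : Lhat / (L₁ * L) *
      ((c + 1) / (c + 2) * Real.exp (c ^ 2 + 2 * c) + 1 / (c + 2)) * c ≤ 1) :
    -- the constant `C` depends on the parameters above only
    ∃ C : ℝ, 0 < C ∧ ∀ (n : ℕ) (ε : ℝ), 1 ≤ n → 0 < ε →
      ∀ (K B : ℕ) (β τ : ℝ) (p : Fin (K + 1) → ℝ),
        K = SSVRG.innerLength θ κ n →
        B = SSVRG.batchSize θ K →
        β = c / K →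
        τ = SSVRG.stepSize (SSVRG.stepFactor c ν L₁ L T) θ K →
        p = SSVRG.selectProb (SSVRG.Delta ν L L₁ Lhat β τ B K) K →
        -- the selection probabilities are well defined
        ((∀ k, 0 ≤ p k) ∧ ∑ k, p k = 1) ∧
        -- a number `S` of epochs that does not depend on the problem instance
        ∃ S : ℕ, 1 ≤ S ∧
          ∀ (d r m : ℕ) (M : Type*) [TopologicalSpace M]
            [ChartedSpace (EuclideanSpace ℝ (Fin m)) M] [IsManifold (𝓡 m) ∞ M]
            [RiemannianBundle (fun x : M => TangentSpace (𝓡 m) x)]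
            [IsContMDiffRiemannianBundle (𝓡 m) ∞ (EuclideanSpace ℝ (Fin m))
              (fun x : M => TangentSpace (𝓡 m) x)]
            (emb : M → SSVRG.Mat d r) (R : (x : M) → TangentSpace (𝓡 m) x → M)
            (f : Fin n → SSVRG.Mat d r → ℝ) (x₀ : M) (γ L₂ : ℝ),
            SSVRG.IsSubmanifold m emb →
            0 < γ → SSVRG.MetricEquivalent m emb ν γ →
            SSVRG.LipschitzGradients emb f L →
            SSVRG.IsRetraction emb R →
            0 < L₂ → SSVRG.RetractionBounds emb R L₁ L₂ T →
            SSVRG.DescentInequality emb R (SSVRG.objective emb f) Lhat T →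
            (∀ y : M, SSVRG.objective emb f x₀ - SSVRG.objective emb f y ≤ D) →
            -- the returned point is a stochastic `ε`-stationary point
            SSVRG.expectation (fun _ : Fin S => p) (fun σ : SSVRG.Seed n B K S =>
              ‖SSVRG.tangentMat emb (SSVRG.run emb f R (fun _ => τ) x₀ σ).val
                (SSVRG.riemannianGrad (m := m) (SSVRG.objective emb f)
                  (SSVRG.run emb f R (fun _ => τ) x₀ σ).val)‖ ^ 2) ≤ ε ∧
            -- every run obeys the bounds on the numbers of oracle calls
            (∀ σ : SSVRG.Seed n B K S,
              ((SSVRG.run emb f R (fun _ => τ) x₀ σ).ifo : ℝ) ≤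
                C * ((n : ℝ) ^ ((2 - θ) / (3 - 2 * θ)) / ε + n) ∧
              ((SSVRG.run emb f R (fun _ => τ) x₀ σ).ro : ℝ) ≤
                C * ((n : ℝ) ^ (θ / (3 - 2 * θ)) / ε + (n : ℝ) ^ (1 / (3 - 2 * θ)))) ∧
            -- the special case `θ = 0`
            (θ = 0 → ∀ σ : SSVRG.Seed n B K S,
              ((SSVRG.run emb f R (fun _ => τ) x₀ σ).ifo : ℝ) ≤
                C * ((n : ℝ) ^ ((2 : ℝ) / 3) / ε + n) ∧
              ((SSVRG.run emb f R (fun _ => τ) x₀ σ).ro : ℝ) ≤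
                C * (1 / ε + (n : ℝ) ^ ((1 : ℝ) / 3))) := by
  set b := stepFactor c ν L₁ L T with hb
  have hb₀ : 0 < b := stepFactor_pos hc₀ hν hL hL₁ hT
  have hb₁ : b ≤ c * ν / (L₁ * L) := (min_le_left _ _).trans (min_le_left _ _)
  have hbT : b ≤ T := min_le_right _ _
  obtain ⟨C, hC, hcost⟩ := exists_cost_bound hθ₀ hθ₁ hκ
    (show 0 ≤ 2 * |D| / (b * ν) by positivity)
  refine ⟨C, hC, ?_⟩
  rintro n ε hn hε K B β τ p hK hB hβ hτ rfl
  have hK1 : 1 ≤ K := hK ▸ one_le_innerLength hκ hn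
  have hB1 : 1 ≤ B := hB ▸ one_le_batchSize hK1
  have hK0 : (0 : ℝ) < K := by exact_mod_cast hK1
  have hτ₀ : 0 < τ := hτ ▸ stepSize_pos hb₀ hK1
  have hτb : τ ≤ b := hτ ▸ stepSize_le hb₀ hK1 hθ₀
  have hβ₀ : 0 < β := hβ ▸ div_pos hc₀ hK0
  have hKp : 0 < (K : ℝ) ^ (1 - θ) := Real.rpow_pos_of_pos hK0 _
  have hΔ : ∀ k, τ * ν / 2 ≤ Delta ν L L₁ Lhat β τ B K k := fun k =>
    half_le_Delta hc₀ hν hL hL₁ hLhat hc hK1 hβ hτ₀.le (hτb.trans hb₁) (by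
      rw [hτ, hB]
      exact stepSize_sq_div_batchSize_le hb₀ hb₁ hν hL hL₁ hK1)
  have hW : b * (K : ℝ) ^ (1 - θ) * ν / 2 ≤
      ∑ j ∈ Finset.range K, Delta ν L L₁ Lhat β τ B K j := by
    have h := Finset.card_nsmul_le_sum (Finset.range K) (Delta ν L L₁ Lhat β τ B K) (τ * ν / 2)
      fun k _ => hΔ k
    rw [Finset.card_range, nsmul_eq_mul] at h
    rw [← mul_stepSize hK1, ← hτ]
    linarith
  have hW₀ : 0 < ∑ j ∈ Finset.range K, Delta ν L L₁ Lhat β τ B K j :=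
    lt_of_lt_of_le (by positivity) hW
  have hp := sum_selectProb hW₀
  refine ⟨⟨selectProb_nonneg fun k _ => le_trans (by positivity) (hΔ k), hp⟩, ?_⟩
  -- `y` epochs would give `|D| / (y · bν K^{1-θ}/2) = ε` for `D ≠ 0`. The absolute value covers
  -- negative `D`, since `S` is fixed before any problem instance; the extra epoch ensures `S ≥ 1`
  -- when `y = 0`.
  set y := 2 * |D| / (b * ν) / ((K : ℝ) ^ (1 - θ) * ε) with hy
  have hy₀ : 0 ≤ y := by positivity
  refine ⟨⌈y⌉₊ + 1, by omega, ?_⟩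
  have hS : ((⌈y⌉₊ + 1 : ℕ) : ℝ) ≤ y + 2 := by
    push_cast
    linarith [Nat.ceil_lt_add_one hy₀]
  have hS' : y ≤ ((⌈y⌉₊ + 1 : ℕ) : ℝ) := by
    push_cast
    linarith [Nat.le_ceil y]
  have hS₀ : (0 : ℝ) < ((⌈y⌉₊ + 1 : ℕ) : ℝ) := by positivity
  generalize ⌈y⌉₊ + 1 = S at hS hS' hS₀ ⊢
  intro d r m M _ _ _ _ _ emb R f x₀ γ L₂ hemb _ hmet hf _ _ hR hdesc hD
  have hcosts := hcost n ε K B S hn hε hK hB hS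
  have hcounts : ∀ σ : Seed n B K S,
      ((run emb f R (fun _ => τ) x₀ σ).ifo : ℝ) ≤
        C * ((n : ℝ) ^ ((2 - θ) / (3 - 2 * θ)) / ε + n) ∧
      ((run emb f R (fun _ => τ) x₀ σ).ro : ℝ) ≤
        C * ((n : ℝ) ^ (θ / (3 - 2 * θ)) / ε + (n : ℝ) ^ (1 / (3 - 2 * θ))) := fun σ => by
    rw [run_ifo, run_ro]
    push_cast
    exact hcosts
  refine ⟨?_, hcounts, ?_⟩
  · refine (expectation_gradNormSq_le hn hB1 hν hLhat hemb hmet hf hR hdesc hτ₀.le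
      (hτb.trans hbT) hβ₀ x₀ hD hp hW₀).trans ?_
    rw [div_le_iff₀ (by positivity)]
    calc D ≤ |D| := le_abs_self D
      _ = ε * (y * (b * (K : ℝ) ^ (1 - θ) * ν / 2)) := by
          rw [hy]
          field_simp
      _ ≤ _ := by gcongr
  · rintro rfl σ
    have h := hcounts σ
    norm_num at h
    simpa using h

end
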